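/- Let $p$ be a prime. For a finite $p$-group $S$ and a subgroup $H \le S$, let $\Omega_1(H)$ be the subgroup generated by the elements of $H$ of order dividing $p$; write $[A,B;0]=A$, $[A,B;n+1]=[[A,B;n],B]$, and $[A,x;n]=[A,\langle x\rangle;n]$. Let $J_e(S)$ be the subgroup generated by the elementary abelian subgroups of $S$ of maximum order. Let $\mathfrak{X}_3(S)$ be the largest subgroup of $S$ for which there is a series $1 = Q_0 < Q_1 < \cdots < Q_n = \mathfrak{X}_3(S)$ with each $Q_i$ normal in $S$ and $[\Omega_1(C_S(Q_{i-1})), Q_i; 2] = 1$ for $1 \le i \le n$. Proposition. Let $p \ge 5$ and let $S$ be a finite $p$-group such that $J_e(S)$ is not contained in $\mathfrak{X}_3(S)$. Set $G = S/\mathfrak{X}_3(S)$, acting by conjugation on $V = \Omega_1(Z(\mathfrak{X}_3(S)))$, and call $a \in G$ quadratic if $[V,a] \ne 1$ and $[V,a,a]=1$ (that is, $a$ has minimal polynomial of degree $2$ on $V$). Then: (1) $\mathfrak{X}_3(G)$ is a proper subgroup of $G$. (2) There is a normal elementary abelian subgroup $W$ of $G$ such that $W = \langle a^G\rangle$ is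 generated by the $G$-conjugates of a quadratic element $a$ and, for each $x \in G$, either $[W,x]=1$ or $[W,x;2] \ne 1$. (3) For every subgroup $W$ as in (2), $\mathfrak{X}_3(G) \le C_G(W)$ and $C_G(W)$ is a proper subgroup of $G$. -/

import Mathlib

namespace OliverGroup

variable {S : Type*} [Group S]

/-- `[A, B; n]`: `[A, B; 0] = A` and `[A, B; n + 1] = [[A, B; n], B]`. -/
def iterComm (A B : Subgroup S) : ℕ → Subgroup S
  | 0 => A
  | n + 1 => ⁅iterComm A B n, B⁆

/-- `Ω₁(H)`: the subgroup generated by the elements of `H` of order dividing `p`. -/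
def omegaOne (p : ℕ) (H : Subgroup S) : Subgroup S :=
  Subgroup.closure {x | x ∈ H ∧ x ^ p = 1}

/-- `A` is an elementary abelian `p`-subgroup (possibly trivial). -/
def IsElementaryAbelian (p : ℕ) (A : Subgroup S) : Prop :=
  (∀ x ∈ A, ∀ y ∈ A, x * y = y * x) ∧ ∀ x ∈ A, x ^ p = 1

/-- `J_e(S)`: the subgroup generated by the elementary abelian `p`-subgroups of maximum order. -/
def thompson (p : ℕ) (S : Type*) [Group S] : Subgroup S :=
  sSup {A | IsElementaryAbelian p A ∧
    ∀ B : Subgroup S, IsElementaryAbelian p B → Nat.card B ≤ Nat.card A}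

/-- There is a series `1 = Q₀ < Q₁ < ⋯ < Qₙ = X` of normal subgroups of `S` with
`[Ω₁(C_S(Qᵢ)), Qᵢ₊₁; k - 1] = 1` for all `i < n`. -/
def HasOliverSeries (p k : ℕ) (X : Subgroup S) : Prop :=
  ∃ (n : ℕ) (Q : ℕ → Subgroup S), Q 0 = ⊥ ∧ Q n = X ∧
    (∀ i ≤ n, (Q i).Normal) ∧
    ∀ i < n, Q i < Q (i + 1) ∧
      iterComm (omegaOne p (Subgroup.centralizer (Q i : Set S))) (Q (i + 1)) (k - 1) = ⊥

/-- The `k`-th Oliver subgroup `𝔛_k(S)`. It is defined as the join of all subgroups that have such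
a series; by `isGreatest_oliver` it is, for finite `S`, the largest subgroup that has one. -/
def oliver (p k : ℕ) (S : Type*) [Group S] : Subgroup S :=
  sSup {X | HasOliverSeries p k X}

theorem HasOliverSeries.normal {p k : ℕ} {X : Subgroup S} (h : HasOliverSeries p k X) :
    X.Normal := by
  obtain ⟨n, Q, -, rfl, hN, -⟩ := h
  exact hN n le_rfl

theorem HasOliverSeries.bot (p k : ℕ) : HasOliverSeries p k (⊥ : Subgroup S) :=
  ⟨0, fun _ => ⊥, rfl, rfl, fun _ _ => inferInstance, fun _ h => absurd h (Nat.not_lt_zero _)⟩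

theorem HasOliverSeries.step {p k : ℕ} {X Y : Subgroup S} (h : HasOliverSeries p k X)
    (hXY : X ≤ Y) (hY : Y.Normal)
    (hc : iterComm (omegaOne p (Subgroup.centralizer (X : Set S))) Y (k - 1) = ⊥) :
    HasOliverSeries p k Y := by
  rcases hXY.eq_or_lt with rfl | hlt
  · exact h
  obtain ⟨n, Q, h0, rfl, hN, hQ⟩ := h
  refine ⟨n + 1, fun i => if i ≤ n then Q i else Y, by simp [h0], by simp, ?_, ?_⟩
  · intro i _
    by_cases hi : i ≤ n
    · simpa [hi] using hN i hi
    · simpa [hi] using hY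
  · intro i hi
    rcases (Nat.lt_succ_iff.mp hi).eq_or_lt with rfl | hi
    · simpa using ⟨hlt, hc⟩
    · have h1 : i ≤ n := hi.le
      have h2 : i + 1 ≤ n := hi
      simpa [h1, h2] using hQ i hi

theorem omegaOne_mono {p : ℕ} {H K : Subgroup S} (h : H ≤ K) : omegaOne p H ≤ omegaOne p K :=
  Subgroup.closure_mono fun _ hx => ⟨h hx.1, hx.2⟩

theorem omegaOne_le (p : ℕ) (H : Subgroup S) : omegaOne p H ≤ H :=
  (Subgroup.closure_le _).2 fun _ hx => hx.1

instance omegaOne_normal (p : ℕ) (H : Subgroup S) [hH : H.Normal] : (omegaOne p H).Normal := by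
  refine ⟨fun x hx g => ?_⟩
  have : omegaOne p H ≤ (omegaOne p H).comap (MulAut.conj g).toMonoidHom := by
    refine (Subgroup.closure_le _).2 fun y hy => ?_
    refine Subgroup.subset_closure ⟨hH.conj_mem y hy.1 g, ?_⟩
    rw [← map_pow, hy.2, map_one]
  exact this hx

theorem iterComm_mono {A A' B B' : Subgroup S} (hA : A ≤ A') (hB : B ≤ B') (n : ℕ) :
    iterComm A B n ≤ iterComm A' B' n := by
  induction n with
  | zero => exact hA
  | succ n ih => exact Subgroup.commutator_mono ih hB

theorem iterComm_le {A : Subgroup S} [A.Normal] (B : Subgroup S) (n : ℕ) : iterComm A B n ≤ A := by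
  induction n with
  | zero => exact le_rfl
  | succ n ih => exact (Subgroup.commutator_mono ih le_rfl).trans (Subgroup.commutator_le_left A B)

open scoped commutatorElement in
theorem iterComm_sup_le {A X Y : Subgroup S} [A.Normal] [X.Normal]
    (hAX : A ≤ Subgroup.centralizer (X : Set S)) (n : ℕ) :
    iterComm A (X ⊔ Y) n ≤ iterComm A Y n := by
  induction n with
  | zero => exact le_rfl
  | succ n ih =>
    refine Subgroup.commutator_le.2 fun a ha b hb => ?_
    obtain ⟨x, hx, y, hy, rfl⟩ := Subgroup.mem_sup_of_normal_left.1 hb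
    have hcx : ∀ c ∈ A, x * c = c * x := fun c hc => hAX hc x hx
    have h1 : y * a⁻¹ * y⁻¹ ∈ A :=
      Subgroup.Normal.conj_mem inferInstance _ (inv_mem (iterComm_le _ n ha)) y
    have : ⁅a, x * y⁆ = ⁅a, y⁆ := by
      have h2 : x * (y * a⁻¹ * y⁻¹) * x⁻¹ = y * a⁻¹ * y⁻¹ := by
        rw [hcx _ h1, mul_inv_cancel_right]
      calc ⁅a, x * y⁆ = a * (x * (y * a⁻¹ * y⁻¹) * x⁻¹) := by
            simp only [commutatorElement_def]; group
        _ = ⁅a, y⁆ := by rw [h2]; simp only [commutatorElement_def]; group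
    rw [this]
    exact Subgroup.commutator_mem_commutator (ih ha) hy

theorem HasOliverSeries.sup {p k : ℕ} {X Y : Subgroup S} (hX : HasOliverSeries p k X)
    (hY : HasOliverSeries p k Y) : HasOliverSeries p k (X ⊔ Y) := by
  obtain ⟨n, Q, h0, rfl, hN, hQ⟩ := hY
  have key : ∀ i ≤ n, HasOliverSeries p k (X ⊔ Q i) := by
    intro i
    induction i with
    | zero => intro _; simpa [h0] using hX
    | succ i ih =>
      intro hi
      have hprev := ih (by omega)
      obtain ⟨hlt, hc⟩ := hQ i hi
      have := hX.normal
      have := hN (i + 1) hi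
      have := hprev.normal
      refine hprev.step (sup_le_sup_left hlt.le X) inferInstance ?_
      have hcen : ∀ Z : Subgroup S, Z ≤ X ⊔ Q i →
          Subgroup.centralizer ((X ⊔ Q i : Subgroup S) : Set S) ≤
            Subgroup.centralizer (Z : Set S) :=
        fun Z hZ => Subgroup.centralizer_le hZ
      have h1 := iterComm_sup_le (Y := Q (i + 1))
        ((omegaOne_le p _).trans (hcen X le_sup_left)) (k - 1)
      refine le_bot_iff.1 (h1.trans ?_)
      rw [← hc]
      exact iterComm_mono (omegaOne_mono (hcen _ le_sup_right)) le_rfl _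
  exact key n le_rfl

theorem isGreatest_oliver (p k : ℕ) (S : Type*) [Group S] [Finite S] :
    IsGreatest {X : Subgroup S | HasOliverSeries p k X} (oliver p k S) := by
  obtain ⟨M, hM, hmax⟩ := (Set.toFinite {X : Subgroup S | HasOliverSeries p k X}).exists_maximal
    ⟨⊥, HasOliverSeries.bot p k⟩
  have hub : ∀ X ∈ {X : Subgroup S | HasOliverSeries p k X}, X ≤ M := fun X hX =>
    le_sup_left.trans (hmax (HasOliverSeries.sup hX hM) le_sup_right)
  have : oliver p k S = M := le_antisymm (sSup_le hub) (le_sSup hM)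
  rw [this]
  exact ⟨hM, hub⟩

instance oliver_normal (p k : ℕ) (S : Type*) [Group S] : (oliver p k S).Normal := by
  have h : ∀ g : S, oliver p k S ≤ (oliver p k S).comap (MulAut.conj g).toMonoidHom := by
    intro g
    refine sSup_le fun X hX x hx => ?_
    exact le_sSup (a := X) hX ((HasOliverSeries.normal hX).conj_mem x hx g)
  exact ⟨fun x hx g => h g hx⟩

/-- `Ω₁(Z(X))`, as a subgroup of `S`; here `Z(X) = X ∩ C_S(X)`. -/
def omegaCenter (p : ℕ) (X : Subgroup S) : Subgroup S :=
  omegaOne p (X ⊓ Subgroup.centralizer (X : Set S))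

instance omegaCenter_normal (p : ℕ) (X : Subgroup S) [X.Normal] : (omegaCenter p X).Normal := by
  unfold omegaCenter; infer_instance

/-- The action of `S ⧸ X` on `V = Ω₁(Z(X))` induced by conjugation in `S`. -/
def quotientAction (p : ℕ) (X : Subgroup S) [X.Normal] : S ⧸ X →* MulAut (omegaCenter p X) :=
  QuotientGroup.lift X MulAut.conjNormal (by
    intro x hx
    ext v
    have hv : (v : S) ∈ Subgroup.centralizer (X : Set S) :=
      ((omegaOne_le p _) v.2).2
    have h : x * (v : S) = v * x := hv x hx
    simp [h])

/-- `g` acts quadratically on `V`: `[V, g, g] = 1` and `[V, g] ≠ 1`, where `[v, g] = v⁻¹ v^g`.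
For `V` an elementary abelian `p`-group this says that `g` has minimal polynomial `(T - 1)²`. -/
def IsQuadratic {G V : Type*} [Group G] [Group V] (φ : G →* MulAut V) (g : G) : Prop :=
  (∀ v : V, (v⁻¹ * φ g v)⁻¹ * φ g (v⁻¹ * φ g v) = 1) ∧ ∃ v : V, v⁻¹ * φ g v ≠ 1

/-- `W` is a normal elementary abelian subgroup of `G`, generated by the `G`-conjugates of a
single element that is quadratic on `V`, such that every `x` in `G` satisfies `[W, x] = 1` or
`[W, x, x] ≠ 1`. -/
structure IsQuadraticCore (p : ℕ) {G V : Type*} [Group G] [Group V] (φ : G →* MulAut V)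
    (W : Subgroup G) : Prop where
  normal : W.Normal
  elementaryAbelian : IsElementaryAbelian p W
  generated : ∃ a : G, IsQuadratic φ a ∧ W = Subgroup.normalClosure {a}
  commutator : ∀ x : G, iterComm W (Subgroup.zpowers x) 1 = ⊥ ∨
    iterComm W (Subgroup.zpowers x) 2 ≠ ⊥

end OliverGroup

namespace OliverGroup

open scoped commutatorElement

/-! ### Quadratic elements and their conjugates -/

/-! Write `X` for the Oliver subgroup of `S`, `V = Ω₁(Z(X))` and `G = S/X`. Since `X` contains its
centralizer (`centralizer_oliver_le`), `Ω₁(C_S(X)) = V`, and maximality of `X` says that a normal `Y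
≥ X` with `[V,Y,Y] = 1` lies in `X`. Hence `C_S(V) = X`, so `G` is faithful on `V`, and no quadratic
element of `G` is central (`not_isQuadratic_of_mem_center`).

An elementary abelian `A` of maximum order outside `X` is at least as large as `V C_A(V)`; this
makes it an offender on `V`, and Thompson replacement extracts a quadratic element
(`exists_quadratic_of_offender`).

Induction on `|G|` replaces that element by a quadratic one whose conjugates commute. Among the
elementary abelian subgroups `⟨a^G⟩` with `a` quadratic, a minimal one is a core: if `[W,x,x] = 1`,
a nontrivial commutator of `x` with a conjugate of `a` would again be quadratic
(`sub_one_sq_eq_zero`), with normal closure inside `[W,G] < W`.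

Along an Oliver series of `G`, the core condition makes each term centralize `W`. Were `C_G(W)` all
of `G`, the quadratic generator of `W` would be central. -/

theorem sub_one_sq_eq_zero_of_comm {R : Type*} [CommRing R] {a b : R} {p : ℕ} (hp : Odd p)
    (hR : (p : R) = 0) (hb : b ^ p = 1) (h0 : (a - 1) ^ 2 = 0) (h1 : (b * a - 1) ^ 2 = 0)
    (h2 : (b * (b * a) - 1) ^ 2 = 0) : (b - 1) ^ 2 = 0 := by
  -- The combination eliminates `a` from the three quadratic relations and leaves `(b + 1)(b - 1)² =
  -- 0`.
  have hneg : b * (b - 1) ^ 2 = -(b - 1) ^ 2 := by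
    linear_combination h2 - b * (b + 1) * h1 + (b ^ 3 * (b + 1) - b ^ 4) * h0
  have hpow : ∀ n : ℕ, b ^ n * (b - 1) ^ 2 = (-1) ^ n * (b - 1) ^ 2 := by
    intro n
    induction n with
    | zero => simp
    | succ n ih => linear_combination b * ih + (-1) ^ n * hneg
  have htwo := hpow p
  rw [hb, hp.neg_one_pow] at htwo
  -- Now `2(b - 1)² = 0`, and `2` is invertible because `2k + 1 = 0` in `R`.
  obtain ⟨k, rfl⟩ := hp
  push_cast at hR
  linear_combination (b - 1) ^ 2 * hR - k * htwo

theorem sub_one_sq_eq_zero {R : Type*} [Ring R] {a b : R} {p : ℕ} (hp : Odd p)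
    (hR : (p : R) = 0) (hab : a * b = b * a) (hb : b ^ p = 1) (h0 : (a - 1) ^ 2 = 0)
    (h1 : (b * a - 1) ^ 2 = 0) (h2 : (b * (b * a) - 1) ^ 2 = 0) : (b - 1) ^ 2 = 0 := by
  have hc : ∀ x ∈ ({a, b} : Set R), ∀ y ∈ ({a, b} : Set R), x * y = y * x := by
    rintro x (rfl | rfl) y (rfl | rfl) <;> simp [hab]
  let T := Subring.closure ({a, b} : Set R)
  have := Subring.isMulCommutative_closure hc
  let _ : CommRing T := { (inferInstance : Ring T) with
    mul_comm := fun x y => this.is_comm.comm x y }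
  let a' : T := ⟨a, Subring.subset_closure (by simp)⟩
  let b' : T := ⟨b, Subring.subset_closure (by simp)⟩
  have := sub_one_sq_eq_zero_of_comm (a := a') (b := b') hp (Subtype.ext (by simpa using hR))
    (Subtype.ext hb) (Subtype.ext h0) (Subtype.ext h1) (Subtype.ext h2)
  exact congrArg Subtype.val this

/-- The ring-valued representation attached to an action on a commutative group. -/
def endHom {G V : Type*} [Group G] [CommGroup V] (φ : G →* MulAut V) :
    G →* AddMonoid.End (Additive V) where
  toFun g := MonoidHom.toAdditive (φ g).toMonoidHom
  map_one' := by rw [map_one]; rfl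
  map_mul' g h := by rw [map_mul]; rfl

section Action

variable {G V : Type*} [Group G] [CommGroup V] {φ : G →* MulAut V}

theorem endHom_apply (g : G) (v : Additive V) :
    endHom φ g v = Additive.ofMul (φ g v.toMul) := rfl

theorem endHom_eq_one_iff {g : G} : endHom φ g = 1 ↔ φ g = 1 := by
  constructor
  · intro h
    ext v
    exact congrArg Additive.toMul (DFunLike.congr_fun h (Additive.ofMul v))
  · intro h
    ext v
    rw [endHom_apply, h]
    rfl

theorem isQuadratic_iff {g : G} :
    IsQuadratic φ g ↔ (endHom φ g - 1) ^ 2 = 0 ∧ φ g ≠ 1 := by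
  have h1 : ∀ v : V, ((endHom φ g - 1) ^ 2 : AddMonoid.End (Additive V)) (Additive.ofMul v) =
      Additive.ofMul ((v⁻¹ * φ g v)⁻¹ * φ g (v⁻¹ * φ g v)) := by
    intro v
    rw [pow_two]
    change Additive.ofMul (φ g (φ g v / v) / (φ g v / v)) = _
    simp [div_eq_mul_inv, mul_comm]
  refine and_congr ⟨fun h => ?_, fun h v => ?_⟩ ?_
  · ext v
    exact (h1 v.toMul).trans (congrArg Additive.ofMul (h v.toMul))
  · have := h1 v
    rw [h] at this
    exact (congrArg Additive.toMul this).symm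
  · rw [← not_iff_not]
    push Not
    constructor
    · intro h
      ext v
      exact (inv_mul_eq_one.1 (h v)).symm
    · intro h v
      rw [h, MulAut.one_apply, inv_mul_cancel]

theorem endHom_conj_sub_one_sq {a : G} (g : G) (ha : (endHom φ a - 1) ^ 2 = 0) :
    (endHom φ (g * a * g⁻¹) - 1) ^ 2 = 0 := by
  have hg : endHom φ g * endHom φ g⁻¹ = 1 := by rw [← map_mul, mul_inv_cancel, map_one]
  have hg' : endHom φ g⁻¹ * endHom φ g = 1 := by rw [← map_mul, inv_mul_cancel, map_one]
  have h1 : endHom φ (g * a * g⁻¹) - 1 = endHom φ g * (endHom φ a - 1) * endHom φ g⁻¹ := by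
    rw [mul_sub, sub_mul, mul_one, hg, map_mul, map_mul]
  calc (endHom φ (g * a * g⁻¹) - 1) ^ 2
      = endHom φ g * (endHom φ a - 1) * (endHom φ g⁻¹ * endHom φ g) *
          (endHom φ a - 1) * endHom φ g⁻¹ := by rw [h1]; noncomm_ring
    _ = endHom φ g * (endHom φ a - 1) ^ 2 * endHom φ g⁻¹ := by rw [hg']; noncomm_ring
    _ = 0 := by rw [ha]; simp

theorem natCast_end_eq_zero {p : ℕ} (hV : ∀ v : V, v ^ p = 1) :
    (p : AddMonoid.End (Additive V)) = 0 := by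
  ext v
  simpa using hV v.toMul

/-- With `N = a - 1` and `N² = 0`, the `n`-th power of `a` acts as `1 + nN`, which is `1` for `n =
p`. -/
theorem pow_eq_one_of_quadratic {p : ℕ} (hV : ∀ v : V, v ^ p = 1)
    (hφ : Function.Injective φ) {a : G} (ha : (endHom φ a - 1) ^ 2 = 0) : a ^ p = 1 := by
  have h1 : ∀ n : ℕ, endHom φ a ^ n = 1 + (n : AddMonoid.End (Additive V)) * (endHom φ a - 1) := by
    intro n
    induction n with
    | zero => simp
    | succ n ih =>
      have h2 : (endHom φ a - 1) * endHom φ a = endHom φ a - 1 := by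
        rw [← sub_eq_zero, ← ha, pow_two, mul_sub _ (endHom φ a) 1, mul_one]
      rw [pow_succ, ih, add_mul, mul_assoc, h2, Nat.cast_succ, add_mul, one_mul, one_mul]
      abel
  apply hφ
  rw [map_one, ← endHom_eq_one_iff, map_pow, h1, natCast_end_eq_zero hV, zero_mul, add_zero]

/-- If the commuting elements `a` and `b = [x, a]` lie in an elementary abelian group, `b` commutes
with `x`, and `a` is quadratic, then `b` is quadratic or trivial. -/
theorem commutator_sub_one_sq {p : ℕ} (hp : Odd p) (hV : ∀ v : V, v ^ p = 1) {a b x : G}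
    (ha : (endHom φ a - 1) ^ 2 = 0) (hab : a * b = b * a) (hx : x * a * x⁻¹ = b * a)
    (hxb : x * b = b * x) (hb : b ^ p = 1) : (endHom φ b - 1) ^ 2 = 0 := by
  have h1 := endHom_conj_sub_one_sq x ha
  have h2 := endHom_conj_sub_one_sq x h1
  -- As `x` commutes with `b`, conjugating twice gives `b²a`. Thus `a`, `ba` and `b²a` are conjugate
  -- and all have square-zero difference from `1`.
  have h3 : x * (x * a * x⁻¹) * x⁻¹ = b * (b * a) := by
    rw [hx, ← mul_assoc, hxb, mul_assoc, mul_assoc, ← mul_assoc x, hx]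
  rw [h3, map_mul, map_mul] at h2
  rw [hx, map_mul] at h1
  exact sub_one_sq_eq_zero hp (natCast_end_eq_zero hV) (by rw [← map_mul, hab, map_mul])
    (by rw [← map_pow, hb, map_one]) ha h1 h2

end Action

/-! ### Existence of a quadratic core -/

/-- Inductively `K` lies in every term of the lower central series. -/
theorem eq_bot_of_le_commutator {G : Type*} [Group G] [Group.IsNilpotent G] {K L : Subgroup G}
    (h : K ≤ ⁅K, L⁆) : K = ⊥ := by
  obtain ⟨n, hn⟩ := Subgroup.nilpotent_iff_lowerCentralSeries.1 (inferInstance : Group.IsNilpotent G)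
  have hK : ∀ n, K ≤ (⊤ : Subgroup G).lowerCentralSeries n := by
    intro n
    induction n with
    | zero => exact le_top
    | succ n ih =>
      rw [Subgroup.lowerCentralSeries_succ]
      exact h.trans (Subgroup.commutator_mono ih le_top)
  exact le_bot_iff.1 (hn ▸ hK n)

theorem normalClosure_singleton {G : Type*} [Group G] (a : G) :
    Subgroup.normalClosure {a} = Subgroup.closure (Set.range fun g : G => g * a * g⁻¹) := by
  unfold Subgroup.normalClosure
  congr 1
  ext x
  simp [Group.mem_conjugatesOfSet_iff, isConj_iff]

theorem conj_mem_normalClosure {G : Type*} [Group G] (a g : G) :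
    g * a * g⁻¹ ∈ Subgroup.normalClosure {a} :=
  (inferInstance : (Subgroup.normalClosure {a}).Normal).conj_mem a
    (Subgroup.subset_normalClosure (Set.mem_singleton a)) g

theorem isElementaryAbelian_closure {G : Type*} [Group G] {p : ℕ} {T : Set G}
    (hc : ∀ x ∈ T, ∀ y ∈ T, x * y = y * x) (hT : ∀ x ∈ T, x ^ p = 1) :
    IsElementaryAbelian p (Subgroup.closure T) := by
  have hcomm : ∀ x ∈ Subgroup.closure T, ∀ y ∈ Subgroup.closure T, x * y = y * x := by
    intro x hx y hy
    have := (Subgroup.isMulCommutative_closure hc).is_comm.comm ⟨x, hx⟩ ⟨y, hy⟩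
    exact congrArg Subtype.val this
  refine ⟨hcomm, fun x hx => ?_⟩
  induction hx using Subgroup.closure_induction with
  | mem x hx => exact hT x hx
  | one => exact one_pow p
  | mul x y hx hy h1 h2 => rw [(show Commute x y from hcomm x hx y hy).mul_pow, h1, h2, one_mul]
  | inv x _ h1 => rw [inv_pow, h1, inv_one]

theorem commutator_zpowers_eq_bot_iff {G : Type*} [Group G] {W : Subgroup G} {x : G} :
    ⁅W, Subgroup.zpowers x⁆ = ⊥ ↔ ∀ w ∈ W, x * w = w * x := by
  rw [Subgroup.commutator_eq_bot_iff_le_centralizer]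
  constructor
  · intro h w hw
    exact h hw x (Subgroup.mem_zpowers x)
  · rintro h w hw _ ⟨k, rfl⟩
    exact ((show Commute x w from h w hw).zpow_left k)

section Core

variable {p : ℕ} {G V : Type*} [Group G] [CommGroup V] {φ : G →* MulAut V}

/-- If `W` is normal of the form `⟨a^G⟩`, minimal among the elementary abelian subgroups of this
kind, then it is a quadratic core. -/
theorem exists_core_of_isElementaryAbelian [Finite G] [Group.IsNilpotent G] (hp : Odd p)
    (hV : ∀ v : V, v ^ p = 1) {a₀ : G}
    (ha₀ : IsQuadratic φ a₀) (hφ : Function.Injective φ)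
    (hc₀ : IsElementaryAbelian p (Subgroup.normalClosure {a₀})) :
    ∃ W, IsQuadraticCore p φ W := by
  let P : Set (Subgroup G) :=
    {W | IsElementaryAbelian p W ∧ ∃ a, IsQuadratic φ a ∧ W = Subgroup.normalClosure {a}}
  obtain ⟨W, ⟨hW, a, ha, rfl⟩, hmin⟩ := (Set.toFinite P).exists_minimal ⟨_, hc₀, a₀, ha₀, rfl⟩
  refine ⟨_, Subgroup.normalClosure_normal, hW, ⟨a, ha, rfl⟩, fun x => ?_⟩
  by_contra! hx
  obtain ⟨h1, h2⟩ := hx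
  apply h1
  have hxc : ∀ w ∈ Subgroup.normalClosure {a}, x * ⁅x, w⁆ = ⁅x, w⁆ * x := by
    intro w hw
    refine commutator_zpowers_eq_bot_iff.1 h2 _ ?_
    rw [← commutatorElement_inv]
    exact inv_mem (Subgroup.commutator_mem_commutator hw (Subgroup.mem_zpowers x))
  have hgen : ∀ g : G, ⁅x, g * a * g⁻¹⁆ = 1 := by
    intro g
    by_contra hb
    have haW := conj_mem_normalClosure a g
    have hbW : ⁅x, g * a * g⁻¹⁆ ∈ ⁅Subgroup.normalClosure {a}, (⊤ : Subgroup G)⁆ := by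
      rw [Subgroup.commutator_comm]
      exact Subgroup.commutator_mem_commutator (Subgroup.mem_top x) haW
    have hle : Subgroup.normalClosure {⁅x, g * a * g⁻¹⁆} ≤
        ⁅Subgroup.normalClosure {a}, (⊤ : Subgroup G)⁆ :=
      Subgroup.normalClosure_le_normal (by simpa using hbW)
    have hle' := Subgroup.commutator_le_left (Subgroup.normalClosure {a}) (⊤ : Subgroup G)
    have hq : (endHom φ ⁅x, g * a * g⁻¹⁆ - 1) ^ 2 = 0 :=
      commutator_sub_one_sq hp hV (endHom_conj_sub_one_sq g (isQuadratic_iff.1 ha).1)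
        (hW.1 _ haW _ (hle' hbW)) (by rw [commutatorElement_def, inv_mul_cancel_right]) (hxc _ haW)
        (hW.2 _ (hle' hbW))
    have hmem : Subgroup.normalClosure {⁅x, g * a * g⁻¹⁆} ∈ P :=
      ⟨⟨fun y hy z hz => hW.1 y (hle' (hle hy)) z (hle' (hle hz)),
        fun y hy => hW.2 y (hle' (hle hy))⟩, _,
        isQuadratic_iff.2 ⟨hq, fun h => hb (hφ (h.trans (map_one φ).symm))⟩, rfl⟩
    -- Minimality gives `W ≤ ⟨b^G⟩ ≤ [W,G]` for the commutator `b`, so nilpotency kills `W` and with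
    -- it `b`.
    have hbot := eq_bot_of_le_commutator ((hmin hmem (hle.trans hle')).trans hle)
    rw [hbot, Subgroup.commutator_bot_left] at hbW
    exact hb hbW
  refine commutator_zpowers_eq_bot_iff.2 fun w hw => ?_
  have hcl : Subgroup.normalClosure {a} ≤ Subgroup.centralizer {x} := by
    refine normalClosure_singleton a ▸ (Subgroup.closure_le _).2 ?_
    rintro _ ⟨g, rfl⟩ y rfl
    exact commutatorElement_eq_one_iff_mul_comm.1 (hgen g)
  exact hcl hw x rfl

/-- Normal conjugate copies of a quadratic core of a normal subgroup commute with it. -/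
theorem IsQuadraticCore.commute_map_conjNormal {M : Subgroup G} [M.Normal] {ψ : M →* MulAut V}
    {W : Subgroup M} (hW : IsQuadraticCore p ψ W) (g : G) {x w : M}
    (hx : x ∈ W.map (MulAut.conjNormal g : MulAut M).toMonoidHom) (hw : w ∈ W) :
    x * w = w * x := by
  have := hW.normal
  have hN : (W.map (MulAut.conjNormal g : MulAut M).toMonoidHom).Normal :=
    hW.normal.map _ (MulAut.conjNormal g : MulAut M).surjective
  have hxle := (Subgroup.zpowers_le).2 hx
  have h1 : ⁅W, Subgroup.zpowers x⁆ ≤ W.map (MulAut.conjNormal g : MulAut M).toMonoidHom :=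
    (Subgroup.commutator_mono le_rfl hxle).trans (Subgroup.commutator_le_right _ _)
  -- The conjugate of `W` is normal in `M` and abelian, and contains both `x` and `[W,x]`; so
  -- `[W,x,x] = 1`, which the core condition upgrades to `[W,x] = 1`.
  refine commutator_zpowers_eq_bot_iff.1 ((hW.commutator x).resolve_right fun h => h ?_) w hw
  refine commutator_zpowers_eq_bot_iff.2 fun y hy => ?_
  obtain ⟨x', hx', rfl⟩ := hx
  obtain ⟨y', hy', rfl⟩ := h1 hy
  rw [← map_mul, hW.elementaryAbelian.1 _ hx' _ hy', map_mul]

end Core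

/-- Unless `G = ⟨a⟩`, the element `a` lies in a maximal subgroup `M`, which is normal. By induction
`M` has a core, and this commutes with its `G`-conjugates; so its quadratic generator has pairwise
commuting `G`-conjugates, and the elementary abelian case applies. -/
theorem exists_core_of_isQuadratic {p : ℕ} [Fact p.Prime] (hp : Odd p) {V : Type*} [CommGroup V]
    (hV : ∀ v : V, v ^ p = 1) {G : Type*} [Group G] [Finite G] (hG : IsPGroup p G)
    (φ : G →* MulAut V) (hφ : Function.Injective φ) {a : G} (ha : IsQuadratic φ a) :
    ∃ W, IsQuadraticCore p φ W := by
  induction hn : Nat.card G using Nat.strong_induction_on generalizing G with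
  | _ n ih =>
  have hnil := hG.isNilpotent
  suffices hc : ∃ a' : G, IsQuadratic φ a' ∧ ∀ g, (g * a' * g⁻¹) * a' = a' * (g * a' * g⁻¹) by
    obtain ⟨a', ha', hc⟩ := hc
    refine exists_core_of_isElementaryAbelian hp hV ha' hφ ?_
    rw [normalClosure_singleton]
    refine isElementaryAbelian_closure ?_ ?_
    · rintro _ ⟨g, rfl⟩ _ ⟨h, rfl⟩
      have := congrArg (fun y => h * y * h⁻¹) (hc (h⁻¹ * g))
      simpa [mul_assoc] using this
    · rintro _ ⟨g, rfl⟩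
      exact pow_eq_one_of_quadratic hV hφ (endHom_conj_sub_one_sq g (isQuadratic_iff.1 ha').1)
  rcases eq_top_or_exists_le_coatom (Subgroup.zpowers a) with htop | ⟨M, hM, haM⟩
  · refine ⟨a, ha, fun g => ?_⟩
    obtain ⟨k, rfl⟩ : g ∈ Subgroup.zpowers a := htop ▸ Subgroup.mem_top g
    have : a ^ k * a * (a ^ k)⁻¹ = a := by
      rw [((Commute.refl a).zpow_left k).eq, mul_inv_cancel_right]
    exact congrArg₂ (· * ·) this this.symm
  · have hMn := Subgroup.NormalizerCondition.normal_of_coatom M Group.normalizerCondition_of_isNilpotent hM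
    have hlt : Nat.card M < n := by
      rw [← hn]
      refine lt_of_le_of_ne (Subgroup.card_le_card_group M) fun h => hM.1 ?_
      exact Subgroup.eq_top_of_card_eq M h
    obtain ⟨W, hW⟩ := ih _ hlt (G := M) (hG.to_subgroup M) (φ.comp M.subtype)
      (hφ.comp M.subtype_injective) (a := ⟨a, haM (Subgroup.mem_zpowers a)⟩) ha rfl
    obtain ⟨b, hb, hWb⟩ := hW.generated
    have hbW : b ∈ W := hWb ▸ Subgroup.subset_normalClosure rfl
    refine ⟨b, hb, fun g => ?_⟩
    have := hW.commute_map_conjNormal g (Subgroup.mem_map_of_mem _ hbW) hbW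
    exact congrArg Subtype.val this

/-! ### Existence of a quadratic element in an offender -/

theorem card_mul_relIndex {S : Type*} [Group S] {H K : Subgroup S} (h : H ≤ K) :
    Nat.card H * H.relIndex K = Nat.card K := by
  simpa using Subgroup.relIndex_mul_relIndex ⊥ H K bot_le h

theorem card_sup_mul_card_inf {S : Type*} [Group S] (V D : Subgroup S) [V.Normal] :
    Nat.card (V ⊔ D : Subgroup S) * Nat.card (V ⊓ D : Subgroup S) =
      Nat.card V * Nat.card D := by
  rw [← card_mul_relIndex (le_sup_left : V ≤ V ⊔ D),
    ← card_mul_relIndex (inf_le_right : V ⊓ D ≤ D), Subgroup.relIndex_sup_left,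
    Subgroup.inf_relIndex_right]
  ring

/-- `f` need not be a homomorphism: applied to chosen coset representatives, it is injective modulo
`F`. -/
theorem relIndex_le_relIndex_of_map {S : Type*} [Group S] [Finite S] {B C F U : Subgroup S}
    (f : S → S) (hf : ∀ b ∈ B, f b ∈ U)
    (hfi : ∀ b ∈ B, ∀ c ∈ B, (f b)⁻¹ * f c ∈ F → b⁻¹ * c ∈ C) :
    C.relIndex B ≤ F.relIndex U := by
  let g : B ⧸ C.subgroupOf B → U ⧸ F.subgroupOf U := fun q =>
    ((⟨f q.out, hf _ q.out.2⟩ : U) : U ⧸ F.subgroupOf U)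
  refine Nat.card_le_card_of_injective g fun q r h => ?_
  have h1 := QuotientGroup.eq.1 h
  rw [← q.out_eq', ← r.out_eq']
  exact QuotientGroup.eq.2 (hfi _ q.out.2 _ r.out.2 h1)

section Offender

variable {S : Type*} [Group S] {V : Subgroup S}

/-- `[v, B]`, generated by the elements `v⁻¹ v^b`. -/
def elementCommutator (v : S) (B : Subgroup S) : Subgroup S :=
  Subgroup.closure {m | ∃ b ∈ B, v⁻¹ * (b * v * b⁻¹) = m}

theorem mem_elementCommutator (v : S) {B : Subgroup S} {b : S} (hb : b ∈ B) :
    v⁻¹ * (b * v * b⁻¹) ∈ elementCommutator v B :=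
  Subgroup.subset_closure ⟨b, hb, rfl⟩

theorem elementCommutator_le_commutator {v : S} (hv : v ∈ V) (B : Subgroup S) :
    elementCommutator v B ≤ ⁅V, B⁆ := by
  refine (Subgroup.closure_le _).2 ?_
  rintro _ ⟨b, hb, rfl⟩
  have := Subgroup.commutator_mem_commutator (inv_mem hv) hb
  rwa [commutatorElement_def, inv_inv, mul_assoc, mul_assoc, ← mul_assoc b] at this

variable [hVn : V.Normal]

theorem elementCommutator_le {v : S} (hv : v ∈ V) (B : Subgroup S) : elementCommutator v B ≤ V :=
  (elementCommutator_le_commutator hv B).trans (Subgroup.commutator_le_left _ _)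

/-- Thompson's replacement inequality: with `M = [v, B]` and `C = C_B(M)`, the index `|B : C|` is at
most `|M C_V(B) : C_V(B)|`. -/
theorem card_mul_card_le_of_elementCommutator [Finite S] (hV : ∀ x ∈ V, ∀ y ∈ V, x * y = y * x)
    {B : Subgroup S} (hB : ∀ x ∈ B, ∀ y ∈ B, x * y = y * x) {v : S} (hv : v ∈ V) :
    Nat.card B * Nat.card (V ⊓ Subgroup.centralizer B : Subgroup S) ≤
      Nat.card (B ⊓ Subgroup.centralizer (elementCommutator v B) : Subgroup S) *
        Nat.card (elementCommutator v B ⊔ V ⊓ Subgroup.centralizer B : Subgroup S) := by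
  rw [← card_mul_relIndex
      (inf_le_left : B ⊓ Subgroup.centralizer (elementCommutator v B : Set S) ≤ B),
    ← card_mul_relIndex (le_sup_right : V ⊓ Subgroup.centralizer (B : Set S) ≤
      elementCommutator v B ⊔ V ⊓ Subgroup.centralizer B), mul_assoc]
  refine Nat.mul_le_mul_left _ ?_
  rw [mul_comm]
  refine Nat.mul_le_mul_left _ ?_
  refine relIndex_le_relIndex_of_map (fun b => v⁻¹ * (b * v * b⁻¹))
    (fun b hb => Subgroup.mem_sup_left (mem_elementCommutator v hb)) ?_
  intro b hb c hc h
  have hconj : ∀ d : S, d * v * d⁻¹ ∈ V := fun d => hVn.conj_mem v hv d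
  set e := b⁻¹ * c with he
  have heB : e ∈ B := mul_mem (inv_mem hb) hc
  refine ⟨heB, ?_⟩
  -- the element `u = [e, v]` is fixed by `B`
  have hu : ∀ d ∈ B, d * (v⁻¹ * (e * v * e⁻¹)) = v⁻¹ * (e * v * e⁻¹) * d := by
    intro d hd
    have h1 := h.2 d hd
    have h2 : (v⁻¹ * (b * v * b⁻¹))⁻¹ * (v⁻¹ * (c * v * c⁻¹)) =
        b * (v⁻¹ * (e * v * e⁻¹)) * b⁻¹ := by rw [he]; group
    have h3 : b * (v⁻¹ * (e * v * e⁻¹)) * b⁻¹ = v⁻¹ * (e * v * e⁻¹) := by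
      have h4 := h.2 b hb
      rw [h2] at h4
      simpa [mul_assoc] using h4
    rwa [h2, h3] at h1
  change e ∈ Subgroup.centralizer (elementCommutator v B : Set S)
  rw [← Subgroup.zpowers_le, Subgroup.le_centralizer_iff]
  refine (Subgroup.closure_le _).2 ?_
  rintro _ ⟨d, hd, rfl⟩
  rw [SetLike.mem_coe, Subgroup.mem_centralizer_iff]
  -- Conjugation by `e` multiplies `v` by `u`. It multiplies `d v d⁻¹` by the same `u`, as `d`
  -- commutes with `e` and fixes `u`; the quotient is therefore fixed.
  suffices hs : e * (v⁻¹ * (d * v * d⁻¹)) * e⁻¹ = v⁻¹ * (d * v * d⁻¹) by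
    rintro _ ⟨k, rfl⟩
    have : Commute e (v⁻¹ * (d * v * d⁻¹)) := by
      exact mul_inv_eq_iff_eq_mul.1 hs
    exact this.zpow_left k
  set u := v⁻¹ * (e * v * e⁻¹) with hudef
  have huV : u ∈ V := mul_mem (inv_mem hv) (hconj e)
  have h5 : e * v * e⁻¹ = v * u := by rw [hudef]; group
  have h6 : e * (d * v * d⁻¹) * e⁻¹ = (d * v * d⁻¹) * u := by
    have : e * (d * v * d⁻¹) * e⁻¹ = d * (e * v * e⁻¹) * d⁻¹ := by
      have hed := hB e heB d hd
      calc e * (d * v * d⁻¹) * e⁻¹ = (e * d) * v * (e * d)⁻¹ := by group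
        _ = d * (e * v * e⁻¹) * d⁻¹ := by rw [hed]; group
    clear_value u
    calc e * (d * v * d⁻¹) * e⁻¹ = d * v * (u * d⁻¹) := by rw [this, h5]; group
      _ = d * v * d⁻¹ * u := by rw [← hu d⁻¹ (inv_mem hd), ← mul_assoc]
  calc e * (v⁻¹ * (d * v * d⁻¹)) * e⁻¹ = (e * v * e⁻¹)⁻¹ * (e * (d * v * d⁻¹) * e⁻¹) := by group
    _ = u⁻¹ * (v⁻¹ * (d * v * d⁻¹) * u) := by rw [h5, h6]; group
    _ = v⁻¹ * (d * v * d⁻¹) := by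
      rw [hV _ (mul_mem (inv_mem hv) (hconj d)) _ huV, inv_mul_cancel_left]

/-- The factor `C_V(B)` contributes nothing to commutators with `B`, so `[V,B] = [V,B,B]`, which is
trivial by nilpotency. -/
theorem le_centralizer_of_le_sup [Group.IsNilpotent S] (hV : ∀ x ∈ V, ∀ y ∈ V, x * y = y * x)
    {B : Subgroup S} (h : V ≤ ⁅V, B⁆ ⊔ V ⊓ Subgroup.centralizer B) :
    V ≤ Subgroup.centralizer B := by
  have hK := Subgroup.commutator_le_left V B
  rw [← Subgroup.commutator_eq_bot_iff_le_centralizer]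
  refine eq_bot_of_le_commutator (L := B) (Subgroup.commutator_le.2 fun x hx b hb => ?_)
  have hmul : ∀ {y z : S}, y ∈ V → z ∈ V → ⁅y * z, b⁆ = ⁅y, b⁆ * ⁅z, b⁆ := by
    intro y z hy hz
    have h1 : ⁅z, b⁆ ∈ V := hK (Subgroup.commutator_mem_commutator hz hb)
    have h2 : ⁅y, b⁆ ∈ V := hK (Subgroup.commutator_mem_commutator hy hb)
    calc ⁅y * z, b⁆ = y * ⁅z, b⁆ * y⁻¹ * ⁅y, b⁆ := by simp only [commutatorElement_def]; group
      _ = ⁅y, b⁆ * ⁅z, b⁆ := by rw [hV y hy _ h1, mul_inv_cancel_right, hV _ h1 _ h2]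
  -- This is a subgroup because `y ↦ [y,b]` is multiplicative on the abelian group `V`.
  let T : Subgroup S :=
    { carrier := {y | y ∈ V ∧ ⁅y, b⁆ ∈ ⁅⁅V, B⁆, B⁆}
      one_mem' := ⟨one_mem _, by simp⟩
      mul_mem' := fun {y z} hy hz => ⟨mul_mem hy.1 hz.1, hmul hy.1 hz.1 ▸ mul_mem hy.2 hz.2⟩
      inv_mem' := fun {y} hy => ⟨inv_mem hy.1, by
        have := hmul (inv_mem hy.1) hy.1
        rw [inv_mul_cancel, commutatorElement_one_left, eq_comm, mul_eq_one_iff_eq_inv] at this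
        exact this ▸ inv_mem hy.2⟩ }
  have hT : ⁅V, B⁆ ⊔ V ⊓ Subgroup.centralizer B ≤ T := by
    refine sup_le (fun y hy => ⟨hK hy, Subgroup.commutator_mem_commutator hy hb⟩) fun y hy => ?_
    refine ⟨hy.1, ?_⟩
    rw [commutatorElement_eq_one_iff_mul_comm.2 (hy.2 b hb).symm]
    exact one_mem _
  exact (hT (h hx)).2

/-- An abelian subgroup `A` with `|A : C_A(V)| |C_V(A)| ≥ |V|` and `C_A(V) < A` has an element
acting quadratically on `V`. -/
theorem exists_quadratic_of_offender [Finite S] [Group.IsNilpotent S]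
    (hV : ∀ x ∈ V, ∀ y ∈ V, x * y = y * x) {A : Subgroup S}
    (hA : ∀ x ∈ A, ∀ y ∈ A, x * y = y * x) (hAV : ¬ A ≤ Subgroup.centralizer V)
    (hcard : Nat.card (A ⊓ Subgroup.centralizer V : Subgroup S) * Nat.card V ≤
      Nat.card A * Nat.card (V ⊓ Subgroup.centralizer A : Subgroup S)) :
    ∃ b, (∀ v ∈ V, b * (v⁻¹ * (b * v * b⁻¹)) = v⁻¹ * (b * v * b⁻¹) * b) ∧
      ∃ v ∈ V, b * v ≠ v * b := by
  set D := A ⊓ Subgroup.centralizer (V : Set S) with hD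
  let P : Set (Subgroup S) := {B | B ≤ A ∧ D < B ∧
    Nat.card D * Nat.card V ≤ Nat.card B * Nat.card (V ⊓ Subgroup.centralizer B : Subgroup S)}
  have hAP : A ∈ P := ⟨le_rfl, inf_lt_left.2 hAV, hcard⟩
  obtain ⟨B, ⟨hBA, hDB, hBc⟩, hmin⟩ := (Set.toFinite P).exists_minimal ⟨A, hAP⟩
  have hB : ∀ x ∈ B, ∀ y ∈ B, x * y = y * x := fun x hx y hy => hA x (hBA hx) y (hBA hy)
  have hBV : ¬ B ≤ Subgroup.centralizer V := fun h => hDB.not_ge (le_inf hBA h)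
  have hquad : ∀ v ∈ V, B ≤ Subgroup.centralizer (elementCommutator v B) := by
    intro v hv
    set M := elementCommutator v B with hM
    set C := B ⊓ Subgroup.centralizer (M : Set S) with hC
    have hMV : M ≤ V := elementCommutator_le hv B
    have hDC : D ≤ C := le_inf hDB.le
      (inf_le_right.trans (Subgroup.centralizer_le hMV))
    have hineq := hBc.trans (card_mul_card_le_of_elementCommutator hV hB hv)
    rw [← hM, ← hC] at hineq
    -- If `C = D`, the inequality forces `V = M C_V(B)`, so `B` centralizes `V`. Otherwise `C`
    -- satisfies the same inequality, since `M C_V(B) ≤ C_V(C)`, and minimality gives `C = B`.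
    rcases hDC.eq_or_lt with heq | hlt
    · exfalso
      rw [heq] at hineq
      have hle := Nat.le_of_mul_le_mul_left hineq Nat.card_pos
      have hVeq := Subgroup.eq_of_le_of_card_ge (sup_le hMV inf_le_left) hle
      have h1 : V ≤ ⁅V, B⁆ ⊔ V ⊓ Subgroup.centralizer B :=
        hVeq.symm.le.trans (sup_le_sup_right (elementCommutator_le_commutator hv B) _)
      exact hBV (Subgroup.le_centralizer_iff.1 (le_centralizer_of_le_sup hV h1))
    · have hCP : C ∈ P := by
        refine ⟨inf_le_left.trans hBA, hlt, hineq.trans (Nat.mul_le_mul_left _ ?_)⟩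
        refine Subgroup.card_le_of_le (sup_le (le_inf hMV ?_)
          (inf_le_inf_left _ (Subgroup.centralizer_le inf_le_left)))
        exact Subgroup.le_centralizer_iff.1 inf_le_right
      exact (hmin hCP inf_le_left).trans inf_le_right
  obtain ⟨b, hbB, hbV⟩ := SetLike.not_le_iff_exists.1 hBV
  refine ⟨b, fun v hv => (hquad v hv hbB _ (mem_elementCommutator v hbB)).symm, ?_⟩
  rw [Subgroup.mem_centralizer_iff] at hbV
  push Not at hbV
  obtain ⟨v, hv, hne⟩ := hbV
  exact ⟨v, hv, hne.symm⟩

end Offender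

/-! ### The Oliver subgroup and its centralizer -/

section Oliver

variable {S : Type*} [Group S]

theorem le_oliver_of_iterComm_eq_bot [Finite S] {p k : ℕ} {Y : Subgroup S} (hY : Y.Normal)
    (hXY : oliver p k S ≤ Y)
    (hc : iterComm (omegaOne p (Subgroup.centralizer (oliver p k S : Set S))) Y (k - 1) = ⊥) :
    Y ≤ oliver p k S :=
  (isGreatest_oliver p k S).2 (HasOliverSeries.step (isGreatest_oliver p k S).1 hXY hY hc)

/-- Take `Y` minimal among normal subgroups of `S` in `C_S(X)` but not in `X`. Nilpotency and
minimality give `[Y,S] ≤ X`, so `[Ω₁(C_S(X)),Y] ≤ X` is centralized by `Y`, and `XY` prolongs the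
series. -/
theorem centralizer_oliver_le [Finite S] [Group.IsNilpotent S] (p : ℕ) :
    Subgroup.centralizer (oliver p 3 S : Set S) ≤ oliver p 3 S := by
  set X := oliver p 3 S with hX
  by_contra hle
  let P : Set (Subgroup S) := {Y | Y.Normal ∧ Y ≤ Subgroup.centralizer X ∧ ¬ Y ≤ X}
  obtain ⟨Y, ⟨hY, hYC, hYX⟩, hmin⟩ :=
    (Set.toFinite P).exists_minimal ⟨_, inferInstance, le_rfl, hle⟩
  have hYle : ⁅Y, (⊤ : Subgroup S)⁆ ≤ Y := Subgroup.commutator_le_left _ _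
  have hYX' : ⁅Y, (⊤ : Subgroup S)⁆ ≤ X := by
    by_contra h
    have := hmin (y := ⁅Y, (⊤ : Subgroup S)⁆) ⟨inferInstance, hYle.trans hYC, h⟩ hYle
    exact hYX (eq_bot_of_le_commutator this ▸ bot_le)
  refine hYX (le_sup_right.trans (le_oliver_of_iterComm_eq_bot (p := p) (k := 3)
    (Y := X ⊔ Y) inferInstance le_sup_left ?_))
  rw [← hX]
  refine le_bot_iff.1 ((iterComm_sup_le (omegaOne_le p _) 2).trans ?_)
  have h1 : ⁅omegaOne p (Subgroup.centralizer (X : Set S)), Y⁆ ≤ X := by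
    rw [Subgroup.commutator_comm]
    exact (Subgroup.commutator_mono le_rfl le_top).trans hYX'
  exact (Subgroup.commutator_mono h1 le_rfl).trans
    (Subgroup.commutator_eq_bot_iff_le_centralizer.2 (Subgroup.le_centralizer_iff.1 hYC)).le

theorem omegaOne_centralizer_oliver [Finite S] [Group.IsNilpotent S] (p : ℕ) :
    omegaOne p (Subgroup.centralizer (oliver p 3 S : Set S)) = omegaCenter p (oliver p 3 S) := by
  rw [omegaCenter, inf_eq_right.2 (centralizer_oliver_le p)]

theorem le_oliver_of_commutator_commutator_eq_bot [Finite S] [Group.IsNilpotent S] {p : ℕ}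
    {Y : Subgroup S} (hY : Y.Normal) (hXY : oliver p 3 S ≤ Y)
    (hc : ⁅⁅omegaCenter p (oliver p 3 S), Y⁆, Y⁆ = ⊥) : Y ≤ oliver p 3 S := by
  rw [← omegaOne_centralizer_oliver] at hc
  exact le_oliver_of_iterComm_eq_bot hY hXY hc

theorem omegaCenter_isElementaryAbelian (p : ℕ) (X : Subgroup S) :
    IsElementaryAbelian p (omegaCenter p X) :=
  isElementaryAbelian_closure (fun _ hx _ hy => hy.1.2 _ hx.1.1) fun _ hx => hx.2

theorem le_centralizer_omegaCenter (p : ℕ) (X : Subgroup S) :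
    X ≤ Subgroup.centralizer (omegaCenter p X) :=
  Subgroup.le_centralizer_iff.1 ((omegaOne_le p _).trans inf_le_right)

/-- `Y = C_S(V)` trivially satisfies `[V,Y,Y] = 1`. This equality is the faithfulness of the
quotient action. -/
theorem centralizer_omegaCenter_oliver [Finite S] [Group.IsNilpotent S] (p : ℕ) :
    Subgroup.centralizer (omegaCenter p (oliver p 3 S) : Set S) = oliver p 3 S := by
  refine le_antisymm ?_ (le_centralizer_omegaCenter p _)
  refine le_oliver_of_commutator_commutator_eq_bot inferInstance
    (le_centralizer_omegaCenter p _) ?_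
  rw [Subgroup.commutator_eq_bot_iff_le_centralizer.2 (Subgroup.le_centralizer_iff.1 le_rfl),
    Subgroup.commutator_bot_left]

theorem quotientAction_mk_apply (p : ℕ) (X : Subgroup S) [X.Normal] (s : S)
    (v : omegaCenter p X) :
    (quotientAction p X (s : S ⧸ X) v : S) = s * v * s⁻¹ := rfl

theorem quotientAction_injective [Finite S] [Group.IsNilpotent S] (p : ℕ) :
    Function.Injective (quotientAction p (oliver p 3 S)) := by
  refine (injective_iff_map_eq_one _).2 fun g hg => ?_
  obtain ⟨s, rfl⟩ := QuotientGroup.mk_surjective g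
  rw [QuotientGroup.eq_one_iff, ← centralizer_omegaCenter_oliver, Subgroup.mem_centralizer_iff]
  intro v hv
  have := congrArg Subtype.val (DFunLike.congr_fun hg ⟨v, hv⟩)
  rw [quotientAction_mk_apply] at this
  exact (mul_inv_eq_iff_eq_mul.1 this).symm

theorem isQuadratic_quotientAction_mk_iff (p : ℕ) (X : Subgroup S) [X.Normal] (s : S) :
    IsQuadratic (quotientAction p X) (s : S ⧸ X) ↔
      (∀ v ∈ omegaCenter p X, s * (v⁻¹ * (s * v * s⁻¹)) = v⁻¹ * (s * v * s⁻¹) * s) ∧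
        ∃ v ∈ omegaCenter p X, s * v ≠ v * s := by
  refine and_congr ⟨fun h v hv => ?_, fun h v => Subtype.ext ?_⟩
    ⟨fun ⟨v, hv⟩ => ⟨v, v.2, fun h => hv (Subtype.ext ?_)⟩,
      fun ⟨v, hv, h⟩ => ⟨⟨v, hv⟩, fun h' => h ?_⟩⟩
  · have := congrArg Subtype.val (h ⟨v, hv⟩)
    have h1 := inv_mul_eq_one.1 this
    exact (mul_inv_eq_iff_eq_mul.1 h1.symm)
  · exact inv_mul_eq_one.2 (eq_mul_inv_iff_mul_eq.2 (h v v.2).symm)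
  · exact inv_mul_eq_one.2 (eq_mul_inv_iff_mul_eq.2 h.symm)
  · exact (mul_inv_eq_iff_eq_mul.1 (inv_mul_eq_one.1 (congrArg Subtype.val h')).symm)

/-- If the Thompson subgroup is not contained in the Oliver subgroup, some element of the quotient
is quadratic. -/
theorem exists_isQuadratic_of_not_thompson_le [Finite S] [Group.IsNilpotent S] {p : ℕ}
    (hJ : ¬ thompson p S ≤ oliver p 3 S) :
    ∃ a, IsQuadratic (quotientAction p (oliver p 3 S)) a := by
  set V := omegaCenter p (oliver p 3 S) with hVdef
  have hV := omegaCenter_isElementaryAbelian p (oliver p 3 S)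
  obtain ⟨A, ⟨hA, hmax⟩, hAX⟩ : ∃ A ∈ {A : Subgroup S | IsElementaryAbelian p A ∧
      ∀ B : Subgroup S, IsElementaryAbelian p B → Nat.card B ≤ Nat.card A},
      ¬ A ≤ oliver p 3 S := by
    by_contra! h
    exact hJ (sSup_le h)
  rw [← centralizer_omegaCenter_oliver] at hAX
  rw [← hVdef] at hV hAX
  have hE : IsElementaryAbelian p (V ⊔ A ⊓ Subgroup.centralizer V : Subgroup S) := by
    rw [Subgroup.sup_eq_closure]
    refine isElementaryAbelian_closure ?_ ?_
    · rintro x (hx | hx) y (hy | hy)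
      · exact hV.1 x hx y hy
      · exact hy.2 x hx
      · exact (hx.2 y hy).symm
      · exact hA.1 x hx.1 y hy.1
    · rintro x (hx | hx)
      · exact hV.2 x hx
      · exact hA.2 x hx.1
  obtain ⟨b, hb⟩ := exists_quadratic_of_offender (V := V) hV.1 hA.1 hAX (by
    -- `|V| |C_A(V)| = |V C_A(V)| |V ∩ C_A(V)|`; the first factor is at most `|A|` by maximality,
    -- the second at most `|C_V(A)|` because `A` is abelian.
    rw [mul_comm, ← card_sup_mul_card_inf]
    refine Nat.mul_le_mul (hmax _ hE) (Subgroup.card_le_of_le (inf_le_inf_left _ ?_))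
    exact fun x hx y hy => hA.1 y hy x hx.1)
  exact ⟨b, (isQuadratic_quotientAction_mk_iff p _ b).2 hb⟩

/-- No central element of the quotient by the Oliver subgroup is quadratic. -/
theorem not_isQuadratic_of_mem_center [Finite S] [Group.IsNilpotent S] {p : ℕ}
    {a : S ⧸ oliver p 3 S} (ha : a ∈ Subgroup.center (S ⧸ oliver p 3 S)) :
    ¬ IsQuadratic (quotientAction p (oliver p 3 S)) a := by
  obtain ⟨s, rfl⟩ := QuotientGroup.mk_surjective a
  rw [isQuadratic_quotientAction_mk_iff]
  rintro ⟨hq, v, hv, hne⟩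
  set X := oliver p 3 S
  set V := omegaCenter p X with hVdef
  have hVc := (omegaCenter_isElementaryAbelian p X).1
  have hXV := le_centralizer_omegaCenter p X
  have hY : (X ⊔ Subgroup.zpowers s).Normal := by
    have h1 : (Subgroup.zpowers (s : S ⧸ X)).Normal := by
      refine ⟨fun n hn g => ?_⟩
      have hn' := (Subgroup.zpowers_le.2 ha) hn
      rwa [Subgroup.mem_center_iff.1 hn' g, mul_inv_cancel_right]
    have h2 : X ⊔ Subgroup.zpowers s =
        (Subgroup.zpowers (s : S ⧸ X)).comap (QuotientGroup.mk' X) := by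
      rw [← QuotientGroup.mk'_apply, ← MonoidHom.map_zpowers, Subgroup.comap_map_eq,
        QuotientGroup.ker_mk', sup_comm]
    rw [h2]
    exact h1.comap _
  -- With `Y = X⟨s⟩`, the aim is `[V,Y] ≤ U` and `[U,Y] = 1`; `X` acts trivially on `V`, so only `s`
  -- matters.
  let U : Subgroup S := V ⊓ Subgroup.centralizer {s}
  have hUs : X ⊔ Subgroup.zpowers s ≤ Subgroup.centralizer U := by
    refine sup_le (hXV.trans (Subgroup.centralizer_le inf_le_left)) ?_
    rw [Subgroup.zpowers_le, Subgroup.mem_centralizer_iff]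
    exact fun u hu => (hu.2 s rfl).symm
  -- the stabilizer of all cosets of `U` in `V`
  let T : Subgroup S :=
    { carrier := {g | ∀ v ∈ V, v⁻¹ * (g * v * g⁻¹) ∈ U}
      one_mem' := fun v _ => by simp [one_mem]
      mul_mem' := fun {g h} hg hh v hv => by
        have h1 := hg (h * v * h⁻¹) ((omegaCenter_normal p X).conj_mem v hv h)
        have := mul_mem (hh v hv) h1
        convert this using 1
        group
      inv_mem' := fun {g} hg v hv => by
        have := U.inv_mem (hg (g⁻¹ * v * g⁻¹⁻¹) ((omegaCenter_normal p X).conj_mem v hv g⁻¹))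
        convert this using 1
        group }
  have hYT : X ⊔ Subgroup.zpowers s ≤ T := by
    refine sup_le (fun x hx v hv => ?_) (Subgroup.zpowers_le.2 fun v hv => ⟨?_, ?_⟩)
    · have : v * x = x * v := hXV hx v hv
      rw [← this, mul_inv_cancel_right, inv_mul_cancel]
      exact one_mem _
    · exact V.mul_mem (V.inv_mem hv) ((omegaCenter_normal p X).conj_mem v hv s)
    · rintro _ rfl
      exact hq v hv
  have hVY : ⁅V, X ⊔ Subgroup.zpowers s⁆ ≤ U := by
    refine Subgroup.commutator_le.2 fun v hv y hy => ?_
    have : v⁻¹⁻¹ * (y * v⁻¹ * y⁻¹) ∈ U := hYT hy v⁻¹ (inv_mem hv)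
    convert this using 1
    rw [commutatorElement_def]
    group
  have hle := le_oliver_of_commutator_commutator_eq_bot hY le_sup_left
    (le_bot_iff.1 ((Subgroup.commutator_mono hVY le_rfl).trans
      (Subgroup.commutator_eq_bot_iff_le_centralizer.2 (Subgroup.le_centralizer_iff.1 hUs)).le))
  have hs : s ∈ X := hle (Subgroup.mem_sup_right (Subgroup.mem_zpowers s))
  exact hne (hXV hs v hv).symm

end Oliver

/-- The Oliver subgroup centralizes every normal elementary abelian subgroup `W` on which no element
acts quadratically. -/
theorem oliver_le_centralizer {G : Type*} [Group G] [Finite G] {p : ℕ} {W : Subgroup G}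
    (hWp : ∀ w ∈ W, w ^ p = 1)
    (hW : ∀ x : G, iterComm W (Subgroup.zpowers x) 1 = ⊥ ∨
      iterComm W (Subgroup.zpowers x) 2 ≠ ⊥) :
    oliver p 3 G ≤ Subgroup.centralizer W := by
  obtain ⟨n, Q, h0, hn, hN, hQ⟩ := (isGreatest_oliver p 3 G).1
  have key : ∀ i ≤ n, Q i ≤ Subgroup.centralizer W := by
    intro i
    induction i with
    | zero => intro _; rw [h0]; exact bot_le
    | succ i ih =>
      intro hi x hx
      -- Once `Q i` centralizes `W`, the series condition applies to `W` and yields `[W,x,x] = 1`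
      -- for `x` in the next term.
      have hWo : W ≤ omegaOne p (Subgroup.centralizer (Q i : Set G)) := fun w hw =>
        Subgroup.subset_closure
          ⟨Subgroup.le_centralizer_iff.1 (ih (Nat.le_of_succ_le hi)) hw, hWp w hw⟩
      have h2 : iterComm W (Subgroup.zpowers x) 2 = ⊥ := le_bot_iff.1
        ((iterComm_mono hWo (Subgroup.zpowers_le.2 hx) 2).trans (hQ i hi).2.le)
      have h1 := (hW x).resolve_right fun h => h h2
      exact fun w hw => (commutator_zpowers_eq_bot_iff.1 h1 w hw).symm
  exact hn ▸ key n le_rfl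

end OliverGroup

theorem mainTheorem7 (p : ℕ) [Fact p.Prime] (hp : 5 ≤ p)
    (S : Type*) [Group S] [Finite S] (hS : IsPGroup p S)
    (hJ : ¬ OliverGroup.thompson p S ≤ OliverGroup.oliver p 3 S) :
    OliverGroup.oliver p 3 (S ⧸ OliverGroup.oliver p 3 S) < ⊤ ∧
    (∃ W : Subgroup (S ⧸ OliverGroup.oliver p 3 S),
      OliverGroup.IsQuadraticCore p
        (OliverGroup.quotientAction p (OliverGroup.oliver p 3 S)) W) ∧
    ∀ W : Subgroup (S ⧸ OliverGroup.oliver p 3 S),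
      OliverGroup.IsQuadraticCore p
        (OliverGroup.quotientAction p (OliverGroup.oliver p 3 S)) W →
      OliverGroup.oliver p 3 (S ⧸ OliverGroup.oliver p 3 S) ≤
          Subgroup.centralizer (W : Set (S ⧸ OliverGroup.oliver p 3 S)) ∧
        Subgroup.centralizer (W : Set (S ⧸ OliverGroup.oliver p 3 S)) < ⊤ := by
  have := hS.isNilpotent
  have h3 : ∀ W : Subgroup (S ⧸ OliverGroup.oliver p 3 S),
      OliverGroup.IsQuadraticCore p
        (OliverGroup.quotientAction p (OliverGroup.oliver p 3 S)) W →
      OliverGroup.oliver p 3 (S ⧸ OliverGroup.oliver p 3 S) ≤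
          Subgroup.centralizer (W : Set (S ⧸ OliverGroup.oliver p 3 S)) ∧
        Subgroup.centralizer (W : Set (S ⧸ OliverGroup.oliver p 3 S)) < ⊤ := by
    refine fun W hW => ⟨OliverGroup.oliver_le_centralizer hW.elementaryAbelian.2 hW.commutator,
      lt_top_iff_ne_top.2 fun htop => ?_⟩
    obtain ⟨a, ha, hWa⟩ := hW.generated
    refine OliverGroup.not_isQuadratic_of_mem_center ?_ ha
    rw [Subgroup.mem_center_iff]
    intro g
    have hg : g ∈ Subgroup.centralizer (W : Set (S ⧸ OliverGroup.oliver p 3 S)) :=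
      htop ▸ Subgroup.mem_top g
    exact (hg a (hWa ▸ Subgroup.subset_normalClosure rfl)).symm
  obtain ⟨a, ha⟩ := OliverGroup.exists_isQuadratic_of_not_thompson_le hJ
  have hV := OliverGroup.omegaCenter_isElementaryAbelian p (OliverGroup.oliver p 3 S)
  -- The commutative structure extends the existing group instance, so quadraticity keeps its
  -- meaning.
  let _ : CommGroup (OliverGroup.omegaCenter p (OliverGroup.oliver p 3 S)) :=
    { (inferInstance : Group (OliverGroup.omegaCenter p (OliverGroup.oliver p 3 S))) with
      mul_comm := fun x y => Subtype.ext (hV.1 x x.2 y y.2) }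
  have hodd : Odd p := (Fact.out : p.Prime).odd_of_ne_two (by omega)
  obtain ⟨W, hW⟩ : ∃ W, OliverGroup.IsQuadraticCore p
      (OliverGroup.quotientAction p (OliverGroup.oliver p 3 S)) W :=
    OliverGroup.exists_core_of_isQuadratic hodd (fun v => Subtype.ext (hV.2 v v.2))
      (hS.to_quotient _) _ (OliverGroup.quotientAction_injective p) ha
  exact ⟨(h3 W hW).1.trans_lt (h3 W hW).2, ⟨W, hW⟩, h3⟩
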